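/- For integers $n,m\ge 0$ let $R^T(n,m)$ be the 3.12.12 lattice with toroidal boundary condition, on $6(m+1)(n+1)$ vertices: there are two triangles $X_{i,j}$ and $Y_{i,j}$ for each $i\in\mathbb Z/(m+1)$, $j\in\mathbb Z/(n+1)$, the three vertices of $X_{i,j}$ are $x^0_{i,j},x^1_{i,j},x^2_{i,j}$, those of $Y_{i,j}$ are $y^0_{i,j},y^1_{i,j},y^2_{i,j}$, and besides the edges of the triangles there are the edges $y^0_{i,j}x^0_{i,j}$, $y^1_{i,j}x^1_{i,j+1}$ and $y^2_{i,j}x^2_{i+1,j}$ for all $i,j$ (so contracting every triangle gives the hexagonal lattice on the torus). Let $R^C(n,m)$, with cylindrical boundary condition, be obtained from $R^T(n,m)$ by deleting the $n+1$ edges $y^2_{m,j}x^2_{0,j}$ $(0\le j\le n)$, and let $R^F(n,m)$, with free boundary condition, be obtained from $R^C(n,m)$ by deleting the $m+1$ edges $y^1_{i,n}x^1_{i,0}$ $(0\le i\le m)$. Let $M(G)$ denote the number of perfect matchings of a graph $G$. Then, for all $n,m\ge 0$, $$M(R^T(n,m))=2^{mn+m+n+2},\qquad M(R^C(n,m))=2^{mn+m+1},\qquad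 M(R^F(n,m))=2^{mn}.$$ Moreover, each of the three families has entropy $\frac13\ln 2$, that is, for $R=R^T,R^C,R^F$, $$\lim_{n,m\to\infty}\frac{2\ln M(R(n,m))}{6(m+1)(n+1)}=\frac13\ln 2 .$$ -/

import Mathlib

open Filter Topology

/-- The number `M(G)` of perfect matchings of a graph. -/
noncomputable def numPerfectMatchings {V : Type*} (G : SimpleGraph V) : ℕ :=
  Set.ncard {M : G.Subgraph | M.IsPerfectMatching}

/-- The doubly indexed family of graphs `G n m` has entropy `h`: with `ν` the number of vertices,
`2 * log M(G n m) / ν` tends to `h` as `n` and `m` tend to infinity (independently). -/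
def HasEntropy {V : ℕ → ℕ → Type*} (G : ∀ n m, SimpleGraph (V n m)) (h : ℝ) : Prop :=
  Tendsto (fun p : ℕ × ℕ =>
      2 * Real.log (numPerfectMatchings (G p.1 p.2) : ℝ) / (Nat.card (V p.1 p.2) : ℝ))
    (atTop ×ˢ atTop) (𝓝 h)

namespace TwelveTwelve

/-- The vertices of the lattices with `m + 1` rows and `n + 1` columns of unit cells.
Each cell `(i, j)` (row `i`, column `j`) contains two triangles, the first one (`false`) and the
second one (`true`), one for each of the two sites of the hexagonal lattice in that cell. The
three corners of a triangle are labelled by the three bond directions: each corner is an end of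
the bond in that direction. -/
abbrev Vertex (n m : ℕ) : Type := (Fin (m + 1) × Fin (n + 1)) × Bool × Fin 3

/-- The cell reached from the second triangle of a cell along the bond in a direction: direction
`0` stays in the cell, direction `1` goes to the next column, direction `2` to the next row.
Addition in `Fin (k + 1)` is modulo `k + 1`, so rows and columns are closed up cyclically. -/
def next {n m : ℕ} (d : Fin 3) (c : Fin (m + 1) × Fin (n + 1)) : Fin (m + 1) × Fin (n + 1) :=
  match d with
  | 0 => c
  | 1 => (c.1, c.2 + 1)
  | 2 => (c.1 + 1, c.2)

/-- `u` and `v` are two corners of the same triangle (equal corners are discarded below). -/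
def SameTriangle {n m : ℕ} (u v : Vertex n m) : Prop :=
  u.1 = v.1 ∧ u.2.1 = v.2.1

/-- `u` and `v` are the ends of a bond, from a second triangle `u` to a first triangle `v`. -/
def Bond {n m : ℕ} (u v : Vertex n m) : Prop :=
  u.2.1 = true ∧ v.2.1 = false ∧ u.2.2 = v.2.2 ∧ v.1 = next u.2.2 u.1

/-- The 3.12.12 lattice with toroidal boundary condition. -/
def RT (n m : ℕ) : SimpleGraph (Vertex n m) :=
  SimpleGraph.fromRel fun u v => SameTriangle u v ∨ Bond u v

/-- The left boundary vertex of row `i`. -/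
def a {n m : ℕ} (i : Fin (m + 1)) : Vertex n m := ((i, 0), false, 1)

/-- The right boundary vertex of row `i`. -/
def aStar {n m : ℕ} (i : Fin (m + 1)) : Vertex n m := ((i, Fin.last n), true, 1)

/-- The boundary vertex of column `j` in the first row. -/
def b {n m : ℕ} (j : Fin (n + 1)) : Vertex n m := ((0, j), false, 2)

/-- The boundary vertex of column `j` in the last row. -/
def bStar {n m : ℕ} (j : Fin (n + 1)) : Vertex n m := ((Fin.last m, j), true, 2)

/-- The 3.12.12 lattice with cylindrical boundary condition: the `n + 1` edges that join the last
row to the first row are deleted. -/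
def RC (n m : ℕ) : SimpleGraph (Vertex n m) :=
  (RT n m).deleteEdges (Set.range fun j : Fin (n + 1) => s(b j, bStar j))

/-- The 3.12.12 lattice with free boundary condition: in addition, the `m + 1` edges that join the
last column to the first column are deleted. -/
def RF (n m : ℕ) : SimpleGraph (Vertex n m) :=
  (RC n m).deleteEdges (Set.range fun i : Fin (m + 1) => s(a i, aStar i))

end TwelveTwelve

/-! Call the edges between triangles bonds. Each triangle has three corners, so a perfect matching
uses either three bonds there, or one bond and the side opposite to it. Conversely, a set of bonds
that is odd at every triangle extends to exactly one perfect matching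
(`numPerfectMatchings_lattice`). Matchings are thus the solutions of an affine system over `ZMod 2`.

Eliminating the direction-0 bond of each cell leaves one equation per cell: the values on the bonds
of directions 1 and 2 form a closed 1-form on the discrete torus. Once the values on the wrap-around
bonds are subtracted, this form is exact, with a unique potential vanishing on the last row and the
last column (`exists_oddBondSet_eq`, `oddBondSet_injective`). The free bits are the `m + 1` and `n +
1` wrap-around values and the `m * n` remaining values of the potential. Deleting wrap-around bonds
only sets their bits to zero, which gives the other two counts. -/

namespace TwelveTwelve

/-! ### Differences and sums on a cycle -/

section Cyclic

variable {G : Type*} [AddCommGroup G] {k : ℕ}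

/-- A function on a cycle that does not change from one point to the next is constant. -/
theorem eq_of_forall_eq_sub_one {α : Type*} (h : Fin (k + 1) → α) (hh : ∀ i, h i = h (i - 1))
    (i j : Fin (k + 1)) : h i = h j := by
  have key : ∀ i, h i = h 0 := by
    intro i
    induction i using Fin.induction with
    | zero => rfl
    | succ i ih =>
      rw [hh, ← ih]
      congr 1
      rw [sub_eq_iff_eq_add, Fin.coeSucc_eq_succ]
  rw [key i, key j]

theorem sum_sub_one (g : Fin (k + 1) → G) : ∑ i, g (i - 1) = ∑ i, g i :=
  Equiv.sum_comp (Equiv.subRight (1 : Fin (k + 1))) g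

/-- A function on a cycle with sum zero is a difference. -/
theorem exists_sub_eq_of_sum_eq_zero (g : Fin (k + 1) → G) (hg : ∑ i, g i = 0) :
    ∃ h : Fin (k + 1) → G, h (Fin.last k) = 0 ∧ ∀ i, h i - h (i - 1) = g i := by
  have hlast : ∑ x ∈ Finset.Iic (Fin.last k), g x = 0 := by
    rw [← hg]
    congr 1
    ext x
    simp [Fin.le_last]
  -- Partial sums work away from `0`; at `0` the predecessor is the last point, where the vanishing
  -- total is needed.
  refine ⟨fun i => ∑ x ∈ Finset.Iic i, g x, hlast, fun i => ?_⟩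
  induction i using Fin.cases with
  | zero =>
    have h1 : (0 : Fin (k + 1)) - 1 = Fin.last k := by
      rw [sub_eq_iff_eq_add, Fin.last_add_one]
    have h2 : Finset.Iic (0 : Fin (k + 1)) = {0} := by
      ext x
      simp
    simp only [h1, hlast, h2, Finset.sum_singleton, sub_zero]
  | succ i =>
    have h1 : i.succ - 1 = i.castSucc := by
      rw [sub_eq_iff_eq_add, Fin.coeSucc_eq_succ]
    have h2 : Finset.Iic i.succ = insert i.succ (Finset.Iic i.castSucc) := by
      ext x
      simp only [Finset.mem_Iic, Finset.mem_insert, Fin.le_def, Fin.ext_iff, Fin.val_succ,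
        Fin.val_castSucc]
      omega
    simp only [h1]
    rw [h2, Finset.sum_insert (by simp [Fin.le_def])]
    abel

end Cyclic

variable {n m : ℕ}

/-! ### Odd bond sets of the torus -/

/-- Extension by zero of a matrix to one more row and one more column. -/
def extend (S : Fin m → Fin n → ZMod 2) (i : Fin (m + 1)) (j : Fin (n + 1)) : ZMod 2 :=
  if h : (i : ℕ) < m ∧ (j : ℕ) < n then S ⟨i, h.1⟩ ⟨j, h.2⟩ else 0

@[simp] theorem extend_last_left (S : Fin m → Fin n → ZMod 2) (j : Fin (n + 1)) :
    extend S (Fin.last m) j = 0 := by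
  simp [extend]

@[simp] theorem extend_last_right (S : Fin m → Fin n → ZMod 2) (i : Fin (m + 1)) :
    extend S i (Fin.last n) = 0 := by
  simp [extend]

theorem extend_injective :
    Function.Injective (extend : (Fin m → Fin n → ZMod 2) → Fin (m + 1) → Fin (n + 1) → ZMod 2) := by
  intro S S' h
  funext i j
  simpa [extend] using congrFun (congrFun h i.castSucc) j.castSucc

theorem exists_extend_eq (T : Fin (m + 1) → Fin (n + 1) → ZMod 2)
    (h₁ : ∀ j, T (Fin.last m) j = 0) (h₂ : ∀ i, T i (Fin.last n) = 0) :
    ∃ S, extend S = T := by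
  refine ⟨fun i j => T i.castSucc j.castSucc, ?_⟩
  funext i j
  unfold extend
  split_ifs with h
  · rfl
  · by_cases hi : (i : ℕ) < m
    · have hj : j = Fin.last n := by
        ext
        have := j.isLt
        simp only [Fin.val_last]
        omega
      rw [hj, h₂]
    · have hi' : i = Fin.last m := by
        ext
        have := i.isLt
        simp only [Fin.val_last]
        omega
      rw [hi', h₁]

/-- The bonds; a bond is named by its direction and by the cell of its end in a second triangle. -/
abbrev BondIndex (n m : ℕ) : Type := (Fin (m + 1) × Fin (n + 1)) × Fin 3

/-- The inverse of `next d`. -/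
def prev (d : Fin 3) (c : Fin (m + 1) × Fin (n + 1)) : Fin (m + 1) × Fin (n + 1) :=
  match d with
  | 0 => c
  | 1 => (c.1, c.2 - 1)
  | 2 => (c.1 - 1, c.2)

@[simp] theorem next_prev (d : Fin 3) (c : Fin (m + 1) × Fin (n + 1)) : next d (prev d c) = c := by
  fin_cases d <;> simp [next, prev]

@[simp] theorem prev_next (d : Fin 3) (c : Fin (m + 1) × Fin (n + 1)) : prev d (next d c) = c := by
  fin_cases d <;> simp [next, prev]

/-- The bond at a vertex. -/
def bondAt (v : Vertex n m) : BondIndex n m :=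
  (if v.2.1 then v.1 else prev v.2.2 v.1, v.2.2)

/-- The other end of the bond at a vertex. -/
def opp (v : Vertex n m) : Vertex n m :=
  (if v.2.1 then next v.2.2 v.1 else prev v.2.2 v.1, !v.2.1, v.2.2)

/-- The sets of bonds in `K`, given by their indicator functions, that have an odd number of
elements at each triangle. -/
def OddBondSets (K : Set (BondIndex n m)) : Set (BondIndex n m → ZMod 2) :=
  {f | (∀ e, e ∉ K → f e = 0) ∧
    ∀ c s, f (bondAt (c, s, 0)) + f (bondAt (c, s, 1)) + f (bondAt (c, s, 2)) = 1}

/-- A parametrization of the odd bond sets of the torus. -/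
def oddBondSet (p : (Fin (m + 1) → ZMod 2) × (Fin (n + 1) → ZMod 2) × (Fin m → Fin n → ZMod 2))
    (e : BondIndex n m) : ZMod 2 :=
  let A := p.1 e.1.1 + (extend p.2.2 e.1.1 e.1.2 - extend p.2.2 (e.1.1 - 1) e.1.2)
  let B := p.2.1 e.1.2 + (extend p.2.2 e.1.1 e.1.2 - extend p.2.2 e.1.1 (e.1.2 - 1))
  match e.2 with
  | 0 => 1 + A + B
  | 1 => A
  | 2 => B

theorem oddBondSet_one_last (p) (i : Fin (m + 1)) :
    oddBondSet (n := n) p ((i, Fin.last n), 1) = p.1 i := by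
  simp [oddBondSet]

theorem oddBondSet_two_last (p) (j : Fin (n + 1)) :
    oddBondSet (m := m) p ((Fin.last m, j), 2) = p.2.1 j := by
  simp [oddBondSet]

theorem oddBondSet_mem (p) : (oddBondSet p : BondIndex n m → ZMod 2) ∈ OddBondSets Set.univ := by
  refine ⟨by simp, fun c s => ?_⟩
  have h : ∀ x y : ZMod 2, 1 + x + y + x + y = 1 := by decide
  have h2 : (2 : ZMod 2) = 0 := rfl
  cases s
  · simp only [bondAt, prev, oddBondSet, Bool.false_eq_true, if_false]
    -- Each boundary bit, and the potential at the two opposite corners of the square, occurs twice;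
    -- its other two corners cancel.
    linear_combination (p.1 c.1 + p.2.1 c.2 + extend p.2.2 c.1 c.2
      - extend p.2.2 (c.1 - 1) (c.2 - 1)) * h2
  · simpa only [bondAt, oddBondSet, if_true] using h _ _

theorem oddBondSet_injective :
    Function.Injective (oddBondSet (n := n) (m := m)) := by
  rintro ⟨α, β, S⟩ ⟨α', β', S'⟩ h
  have hα : α = α' := by
    funext i
    simpa only [oddBondSet_one_last] using congrFun h ((i, Fin.last n), 1)
  have hβ : β = β' := by
    funext j
    simpa only [oddBondSet_two_last] using congrFun h ((Fin.last m, j), 2)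
  subst hα hβ
  have hS : S = S' := by
    apply extend_injective
    funext i j
    -- The direction-1 bonds fix the potential up to a constant in each column, and the zero last
    -- row fixes that constant.
    have := eq_of_forall_eq_sub_one (fun i => extend S i j - extend S' i j)
      (fun i => by
        have := congrFun h ((i, j), 1)
        simp only [oddBondSet] at this
        linear_combination this) i (Fin.last m)
    simpa [sub_eq_zero] using this
  rw [hS]

/-- A discrete Poincaré lemma: normalizing by the wrap-around values removes the periods, so the
potential is found by summing `A` along each column. -/
theorem exists_oddBondSet_eq {f : BondIndex n m → ZMod 2} (hf : f ∈ OddBondSets Set.univ) :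
    ∃ p, oddBondSet p = f := by
  have hf := hf.2
  have h2 : (2 : ZMod 2) = 0 := rfl
  set A : Fin (m + 1) → Fin (n + 1) → ZMod 2 :=
    fun i j => f ((i, j), 1) - f ((i, Fin.last n), 1) with hA
  set B : Fin (m + 1) → Fin (n + 1) → ZMod 2 :=
    fun i j => f ((i, j), 2) - f ((Fin.last m, j), 2) with hB
  -- Closedness: compare the two triangles joined by the direction-0 bond of the cell, whose value
  -- drops out.
  have hAB : ∀ i j, A i j - A i (j - 1) = B i j - B (i - 1) j := by
    intro i j
    have h₁ := hf (i, j) true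
    have h₀ := hf (i, j) false
    simp only [bondAt, prev, Bool.false_eq_true, if_false, if_true] at h₀ h₁
    simp only [hA, hB]
    linear_combination h₁ - h₀ + (f ((i - 1, j), 2) - f ((i, j), 2)) * h2
  have hAlast : ∀ i, A i (Fin.last n) = 0 := by simp [hA]
  have hBlast : ∀ j, B (Fin.last m) j = 0 := by simp [hB]
  -- By closedness the period changes with `j` by a telescoping sum of `B`, and it is zero in the
  -- last column.
  have hsum : ∀ j, ∑ i, A i j = 0 := by
    intro j
    rw [eq_of_forall_eq_sub_one (fun j => ∑ i, A i j) _ j (Fin.last n)]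
    · simp [hAlast]
    · intro j
      rw [← sub_eq_zero, ← Finset.sum_sub_distrib]
      simp only [hAB, Finset.sum_sub_distrib]
      rw [sum_sub_one (fun i => B i j), sub_self]
  choose T hTlast hT using fun j => exists_sub_eq_of_sum_eq_zero (fun i => A i j) (hsum j)
  obtain ⟨S, hS⟩ := exists_extend_eq (fun i j => T j i) hTlast (fun i => by
    rw [← hTlast (Fin.last n)]
    exact eq_of_forall_eq_sub_one (T (Fin.last n))
      (fun i => by rw [← sub_eq_zero, hT, hAlast]) _ _)
  -- By closedness the error is constant in `i`, and in the last row all its terms vanish.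
  have hTB : ∀ i j, T j i - T (j - 1) i = B i j := by
    intro i j
    have := eq_of_forall_eq_sub_one (fun i => T j i - T (j - 1) i - B i j)
      (fun i => by linear_combination hT j i - hT (j - 1) i + hAB i j) i (Fin.last m)
    simpa [hTlast, hBlast, sub_eq_zero] using this
  have h1 : ∀ i j, f ((i, Fin.last n), 1) + (T j i - T j (i - 1)) = f ((i, j), 1) := by
    intro i j
    rw [hT]
    simp [hA]
  have h2' : ∀ i j, f ((Fin.last m, j), 2) + (T j i - T (j - 1) i) = f ((i, j), 2) := by
    intro i j
    rw [hTB]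
    simp [hB]
  refine ⟨(fun i => f ((i, Fin.last n), 1), fun j => f ((Fin.last m, j), 2), S), ?_⟩
  funext ⟨⟨i, j⟩, d⟩
  fin_cases d
  · have h := hf (i, j) true
    simp only [bondAt, if_true] at h
    simp only [oddBondSet, hS, h1, h2', Fin.zero_eta]
    linear_combination -h + (f ((i, j), 1) + f ((i, j), 2)) * h2
  · simp only [oddBondSet, hS, h1, Fin.mk_one]
  · simp only [oddBondSet, hS, h2', Fin.reduceFinMk]

/-! ### Odd bond sets with boundary, and the three counts -/

/-- The bonds of the cylinder. -/
def cylinderBonds (n m : ℕ) : Set (BondIndex n m) := {e | ¬(e.1.1 = Fin.last m ∧ e.2 = 2)}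

/-- The bonds of the lattice with free boundary. -/
def freeBonds (n m : ℕ) : Set (BondIndex n m) :=
  {e | e ∈ cylinderBonds n m ∧ ¬(e.1.2 = Fin.last n ∧ e.2 = 1)}

theorem oddBondSets_univ : OddBondSets (Set.univ : Set (BondIndex n m)) = Set.range oddBondSet :=
  Set.Subset.antisymm (fun _ hf => exists_oddBondSet_eq hf)
    (Set.range_subset_iff.2 oddBondSet_mem)

theorem mem_oddBondSets_iff {K : Set (BondIndex n m)} {f : BondIndex n m → ZMod 2} :
    f ∈ OddBondSets K ↔ f ∈ OddBondSets Set.univ ∧ ∀ e, e ∉ K → f e = 0 := by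
  exact ⟨fun h => ⟨⟨fun e he => absurd (Set.mem_univ e) he, h.2⟩, h.1⟩, fun h => ⟨h.2, h.1.2⟩⟩

theorem oddBondSets_cylinder : OddBondSets (cylinderBonds n m) =
    Set.range fun p : (Fin (m + 1) → ZMod 2) × (Fin m → Fin n → ZMod 2) =>
      oddBondSet (p.1, 0, p.2) := by
  ext f
  rw [mem_oddBondSets_iff, oddBondSets_univ]
  constructor
  · rintro ⟨⟨⟨α, β, S⟩, rfl⟩, h⟩
    have hβ : β = 0 := by
      funext j
      simpa only [oddBondSet_two_last, Pi.zero_apply] using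
        h ((Fin.last m, j), 2) (by simp [cylinderBonds])
    exact ⟨(α, S), by rw [hβ]⟩
  · rintro ⟨⟨α, S⟩, rfl⟩
    refine ⟨⟨_, rfl⟩, ?_⟩
    rintro ⟨⟨i, j⟩, d⟩ h
    obtain ⟨rfl, rfl⟩ : i = Fin.last m ∧ d = 2 := by simpa [cylinderBonds] using h
    simp only [oddBondSet_two_last, Pi.zero_apply]

theorem oddBondSets_free : OddBondSets (freeBonds n m) =
    Set.range fun S : Fin m → Fin n → ZMod 2 => oddBondSet (0, 0, S) := by
  ext f
  rw [mem_oddBondSets_iff, oddBondSets_univ]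
  constructor
  · rintro ⟨⟨⟨α, β, S⟩, rfl⟩, h⟩
    have hα : α = 0 := by
      funext i
      simpa only [oddBondSet_one_last, Pi.zero_apply] using
        h ((i, Fin.last n), 1) (by simp [freeBonds])
    have hβ : β = 0 := by
      funext j
      simpa only [oddBondSet_two_last, Pi.zero_apply] using
        h ((Fin.last m, j), 2) (by simp [freeBonds, cylinderBonds])
    exact ⟨S, by rw [hα, hβ]⟩
  · rintro ⟨S, rfl⟩
    refine ⟨⟨_, rfl⟩, ?_⟩
    rintro ⟨⟨i, j⟩, d⟩ h
    have h' : (i = Fin.last m ∧ d = 2) ∨ (j = Fin.last n ∧ d = 1) := by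
      simpa [freeBonds, cylinderBonds, or_iff_not_imp_left] using h
    obtain ⟨rfl, rfl⟩ | ⟨rfl, rfl⟩ := h'
    · simp only [oddBondSet_two_last, Pi.zero_apply]
    · simp only [oddBondSet_one_last, Pi.zero_apply]

theorem ncard_oddBondSets_univ :
    (OddBondSets (Set.univ : Set (BondIndex n m))).ncard = 2 ^ (m * n + m + n + 2) := by
  rw [oddBondSets_univ, ← Set.image_univ, Set.ncard_image_of_injective _ oddBondSet_injective,
    Set.ncard_univ]
  simp only [Nat.card_prod, Nat.card_fun, Nat.card_zmod, Nat.card_fin, ← pow_mul, ← pow_add]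
  congr 1
  ring

theorem ncard_oddBondSets_cylinder :
    (OddBondSets (cylinderBonds n m)).ncard = 2 ^ (m * n + m + 1) := by
  rw [oddBondSets_cylinder, ← Set.image_univ, Set.ncard_image_of_injective, Set.ncard_univ]
  · simp only [Nat.card_prod, Nat.card_fun, Nat.card_zmod, Nat.card_fin, ← pow_mul, ← pow_add]
    congr 1
    ring
  · rintro ⟨α, S⟩ ⟨α', S'⟩ h
    simpa using oddBondSet_injective h

theorem ncard_oddBondSets_free : (OddBondSets (freeBonds n m)).ncard = 2 ^ (m * n) := by
  rw [oddBondSets_free, ← Set.image_univ, Set.ncard_image_of_injective, Set.ncard_univ]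
  · simp only [Nat.card_fun, Nat.card_zmod, Nat.card_fin, ← pow_mul]
    congr 1
    ring
  · intro S S' h
    simpa using oddBondSet_injective h

/-! ### The three graphs as triangles plus a set of bonds -/

theorem bondAt_opp (v : Vertex n m) : bondAt (opp v) = bondAt v := by
  obtain ⟨c, s, d⟩ := v
  cases s <;> simp [bondAt, opp]

theorem opp_ne (v : Vertex n m) : opp v ≠ v := by
  obtain ⟨c, s, d⟩ := v
  simp [opp]

theorem opp_opp (v : Vertex n m) : opp (opp v) = v := by
  obtain ⟨c, s, d⟩ := v
  cases s <;> simp [opp]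

theorem eq_or_eq_opp_of_bondAt_eq {u v : Vertex n m} (h : bondAt u = bondAt v) :
    v = u ∨ v = opp u := by
  obtain ⟨c, s, d⟩ := u
  obtain ⟨c', s', d'⟩ := v
  simp only [bondAt, Prod.mk.injEq] at h
  obtain ⟨h, rfl⟩ := h
  cases s <;> cases s' <;> simp only [Bool.false_eq_true, if_false, if_true] at h
  · left
    rw [← next_prev d c, h, next_prev]
  · right
    simp [opp, h]
  · right
    simp [opp, h]
  · left
    rw [h]

theorem opp_fst_ne (v : Vertex n m) : (opp v).2.1 ≠ v.2.1 := by
  simp [opp]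

theorem not_sameTriangle_opp (v : Vertex n m) : ¬ SameTriangle v (opp v) :=
  fun h => opp_fst_ne v h.2.symm

theorem eq_of_sameTriangle_of_bondAt_eq {u v : Vertex n m} (h : SameTriangle u v)
    (hb : bondAt u = bondAt v) : v = u := by
  obtain rfl | rfl := eq_or_eq_opp_of_bondAt_eq hb
  · rfl
  · exact absurd h (not_sameTriangle_opp u)

/-- The end of a bond in a second triangle. -/
def src (e : BondIndex n m) : Vertex n m := (e.1, true, e.2)

@[simp] theorem bondAt_src (e : BondIndex n m) : bondAt (src e) = e := by
  simp [bondAt, src]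

/-- The unordered pair of ends of a bond. -/
def ends (e : BondIndex n m) : Sym2 (Vertex n m) := s(src e, opp (src e))

/-- The graph whose edges are the sides of the triangles and the bonds in `K`. -/
def lattice (K : Set (BondIndex n m)) : SimpleGraph (Vertex n m) where
  Adj u v := u ≠ v ∧ (SameTriangle u v ∨ bondAt u = bondAt v ∧ bondAt u ∈ K)
  symm := ⟨by
    rintro u v ⟨h, ⟨h₁, h₂⟩ | ⟨h₁, h₂⟩⟩
    · exact ⟨h.symm, Or.inl ⟨h₁.symm, h₂.symm⟩⟩
    · exact ⟨h.symm, Or.inr ⟨h₁.symm, h₁ ▸ h₂⟩⟩⟩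
  loopless := ⟨fun _ h => h.1 rfl⟩

theorem mem_ends_image_iff {D : Set (BondIndex n m)} {u v : Vertex n m} (h : u ≠ v) :
    s(u, v) ∈ ends '' D ↔ bondAt u = bondAt v ∧ bondAt u ∈ D := by
  constructor
  · rintro ⟨e, he, h'⟩
    simp only [ends, Sym2.eq_iff] at h'
    obtain ⟨rfl, rfl⟩ | ⟨rfl, rfl⟩ := h' <;> simpa [bondAt_opp] using he
  · rintro ⟨h₁, h₂⟩
    refine ⟨bondAt u, h₂, ?_⟩
    obtain rfl | rfl := eq_or_eq_opp_of_bondAt_eq h₁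
    · exact absurd rfl h
    · have h₃ : bondAt u = bondAt (src (bondAt u)) := by simp
      obtain h₄ | h₄ := eq_or_eq_opp_of_bondAt_eq h₃
      · rw [ends, h₄]
      · rw [ends, h₄, opp_opp, Sym2.eq_swap]

/-- The ends of a bond lie in triangles of different kinds, so deleting bonds never removes a side
of a triangle. -/
theorem lattice_deleteEdges (K D : Set (BondIndex n m)) :
    (lattice K).deleteEdges (ends '' D) = lattice (K \ D) := by
  ext u v
  rw [SimpleGraph.deleteEdges_adj]
  constructor
  · rintro ⟨⟨h, h'⟩, hD⟩
    rw [mem_ends_image_iff h] at hD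
    exact ⟨h, h'.imp_right fun h₁ => ⟨h₁.1, h₁.2, fun h₂ => hD ⟨h₁.1, h₂⟩⟩⟩
  · rintro ⟨h, h'⟩
    rw [mem_ends_image_iff h]
    refine ⟨⟨h, h'.imp_right fun h₁ => ⟨h₁.1, h₁.2.1⟩⟩, fun hD => ?_⟩
    obtain h₁ | h₁ := h'
    · exact h (eq_of_sameTriangle_of_bondAt_eq h₁ hD.1).symm
    · exact h₁.2.2 hD.2

theorem Bond.bondAt_eq {u v : Vertex n m} (h : Bond u v) : bondAt u = bondAt v := by
  obtain ⟨h₁, h₂, h₃, h₄⟩ := h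
  simp [bondAt, h₁, h₂, ← h₃, h₄]

theorem bond_opp_or (u : Vertex n m) : Bond u (opp u) ∨ Bond (opp u) u := by
  obtain ⟨c, s, d⟩ := u
  cases s <;> simp [Bond, opp]

theorem RT_eq_lattice : RT n m = lattice Set.univ := by
  ext u v
  rw [RT, SimpleGraph.fromRel_adj]
  refine and_congr_right fun h => ⟨?_, ?_⟩
  · rintro ((h | h) | (h | h))
    · exact Or.inl h
    · exact Or.inr ⟨h.bondAt_eq, trivial⟩
    · exact Or.inl ⟨h.1.symm, h.2.symm⟩
    · exact Or.inr ⟨h.bondAt_eq.symm, trivial⟩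
  · rintro (h' | ⟨h', -⟩)
    · exact Or.inl (Or.inl h')
    · obtain rfl | rfl := eq_or_eq_opp_of_bondAt_eq h'
      · exact absurd rfl h
      · exact (bond_opp_or u).imp Or.inr Or.inr

theorem RC_eq_lattice : RC n m = lattice (cylinderBonds n m) := by
  have h : (Set.range fun j : Fin (n + 1) => s(b j, bStar j)) =
      (ends '' {e | e.1.1 = Fin.last m ∧ e.2 = 2} : Set (Sym2 (Vertex n m))) := by
    ext z
    constructor
    · rintro ⟨j, rfl⟩
      refine ⟨((Fin.last m, j), 2), ⟨rfl, rfl⟩, ?_⟩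
      -- `ends` lists the end in the second triangle first, the reverse of the pair here.
      refine Eq.trans Sym2.eq_swap ?_
      simp [src, opp, b, bStar, next]
    · rintro ⟨⟨⟨i, j⟩, d⟩, ⟨rfl, rfl⟩, rfl⟩
      refine ⟨j, ?_⟩
      refine Eq.trans Sym2.eq_swap ?_
      simp [ends, src, opp, b, bStar, next]
  rw [RC, RT_eq_lattice, h, lattice_deleteEdges]
  congr 1
  ext e
  simp [cylinderBonds]

theorem RF_eq_lattice : RF n m = lattice (freeBonds n m) := by
  have h : (Set.range fun i : Fin (m + 1) => s(a i, aStar i)) =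
      (ends '' {e | e.1.2 = Fin.last n ∧ e.2 = 1} : Set (Sym2 (Vertex n m))) := by
    ext z
    constructor
    · rintro ⟨i, rfl⟩
      refine ⟨((i, Fin.last n), 1), ⟨rfl, rfl⟩, ?_⟩
      refine Eq.trans Sym2.eq_swap ?_
      simp [src, opp, a, aStar, next]
    · rintro ⟨⟨⟨i, j⟩, d⟩, ⟨rfl, rfl⟩, rfl⟩
      refine ⟨i, ?_⟩
      refine Eq.trans Sym2.eq_swap ?_
      simp [ends, src, opp, a, aStar, next]
  rw [RF, RC_eq_lattice, h, lattice_deleteEdges]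
  rfl

/-! ### Perfect matchings, triangle by triangle -/

/-- Exactly one of three propositions holds. -/
def ExactlyOne (p q r : Prop) : Prop :=
  (p ∧ ¬q ∧ ¬r) ∨ (¬p ∧ q ∧ ¬r) ∨ (¬p ∧ ¬q ∧ r)

theorem existsUnique_iff_exactlyOne {α : Type*} {p : α → Prop} {x y z : α} (hxy : x ≠ y)
    (hxz : x ≠ z) (hyz : y ≠ z) (h : ∀ w, p w → w = x ∨ w = y ∨ w = z) :
    (∃! w, p w) ↔ ExactlyOne (p x) (p y) (p z) := by
  constructor
  · rintro ⟨w, hw, hu⟩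
    have hu' : ∀ t, t ≠ w → ¬ p t := fun t ht hp => ht (hu t hp)
    obtain rfl | rfl | rfl := h w hw
    · exact Or.inl ⟨hw, hu' _ hxy.symm, hu' _ hxz.symm⟩
    · exact Or.inr (Or.inl ⟨hu' _ hxy, hw, hu' _ hyz.symm⟩)
    · exact Or.inr (Or.inr ⟨hu' _ hxz, hu' _ hyz, hw⟩)
  · rintro (⟨h₁, h₂, h₃⟩ | ⟨h₁, h₂, h₃⟩ | ⟨h₁, h₂, h₃⟩)
    · refine ⟨x, h₁, fun w hw => ?_⟩
      obtain rfl | rfl | rfl := h w hw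
      exacts [rfl, absurd hw h₂, absurd hw h₃]
    · refine ⟨y, h₂, fun w hw => ?_⟩
      obtain rfl | rfl | rfl := h w hw
      exacts [absurd hw h₁, rfl, absurd hw h₃]
    · refine ⟨z, h₃, fun w hw => ?_⟩
      obtain rfl | rfl | rfl := h w hw
      exacts [absurd hw h₁, absurd hw h₂, rfl]

/-- A triangle whose corners are each covered once, by a side of the triangle or from outside, has
an odd number of corners covered from outside, and these determine the side that is used. -/
theorem exactlyOne_triangle_iff (r₀₁ r₁₂ r₂₀ g₀ g₁ g₂ : Prop) :
    ExactlyOne r₀₁ r₂₀ g₀ ∧ ExactlyOne r₁₂ r₀₁ g₁ ∧ ExactlyOne r₂₀ r₁₂ g₂ ↔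
      (r₀₁ ↔ ¬g₀ ∧ ¬g₁) ∧ (r₁₂ ↔ ¬g₁ ∧ ¬g₂) ∧ (r₂₀ ↔ ¬g₂ ∧ ¬g₀) ∧
        (g₀ ∧ g₁ ∧ g₂ ∨ ExactlyOne g₀ g₁ g₂) := by
  by_cases h₁ : r₀₁ <;> by_cases h₂ : r₁₂ <;> by_cases h₃ : r₂₀ <;> by_cases h₄ : g₀ <;>
    by_cases h₅ : g₁ <;> by_cases h₆ : g₂ <;> simp [ExactlyOne, h₁, h₂, h₃, h₄, h₅, h₆]

theorem zmod_two_add_eq_one_iff : ∀ x y z : ZMod 2,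
    x + y + z = 1 ↔ (x = 1 ∧ y = 1 ∧ z = 1 ∨ ExactlyOne (x = 1) (y = 1) (z = 1)) := by
  unfold ExactlyOne
  decide

theorem zmod_two_ne_one_iff : ∀ x : ZMod 2, ¬ x = 1 ↔ x = 0 := by
  decide

theorem eq_or_eq_of_lattice_adj {K : Set (BondIndex n m)} {v w : Vertex n m}
    (h : (lattice K).Adj v w) :
    w = (v.1, v.2.1, v.2.2 + 1) ∨ w = (v.1, v.2.1, v.2.2 + 2) ∨ w = opp v := by
  obtain ⟨h, ⟨h₁, h₂⟩ | ⟨h₁, -⟩⟩ := h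
  · obtain ⟨c, s, d⟩ := v
    obtain ⟨c', s', d'⟩ := w
    dsimp only at h₁ h₂
    subst h₁ h₂
    have hd : d ≠ d' := fun hd => h (by rw [hd])
    have key : ∀ d d' : Fin 3, d ≠ d' → d' = d + 1 ∨ d' = d + 2 := by decide
    obtain rfl | rfl := key d d' hd
    · exact Or.inl rfl
    · exact Or.inr (Or.inl rfl)
  · obtain h₂ | h₂ := eq_or_eq_opp_of_bondAt_eq h₁
    · exact absurd h₂.symm h
    · exact Or.inr (Or.inr h₂)

theorem isPerfectMatching_iff_exactlyOne {K : Set (BondIndex n m)} (M : (lattice K).Subgraph) :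
    M.IsPerfectMatching ↔ ∀ v : Vertex n m, ExactlyOne (M.Adj v (v.1, v.2.1, v.2.2 + 1))
      (M.Adj v (v.1, v.2.1, v.2.2 + 2)) (M.Adj v (opp v)) := by
  rw [SimpleGraph.Subgraph.isPerfectMatching_iff]
  refine forall_congr' fun v => existsUnique_iff_exactlyOne ?_ ?_ ?_
    fun w hw => eq_or_eq_of_lattice_adj (M.adj_sub hw)
  · intro h
    have key : ∀ d : Fin 3, d + 1 ≠ d + 2 := by decide
    exact key v.2.2 (congrArg (fun x : Vertex n m => x.2.2) h)
  · exact fun h => opp_fst_ne v (congrArg (fun x : Vertex n m => x.2.1) h).symm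
  · exact fun h => opp_fst_ne v (congrArg (fun x : Vertex n m => x.2.1) h).symm

/-- A subgraph is a perfect matching when every triangle has an odd number of corners that are
matched along a bond and the other corners are matched with each other. -/
theorem isPerfectMatching_iff_triangle {K : Set (BondIndex n m)} (M : (lattice K).Subgraph) :
    M.IsPerfectMatching ↔ ∀ c s,
      let v : Fin 3 → Vertex n m := fun d => (c, s, d)
      let g : Fin 3 → Prop := fun d => M.Adj (v d) (opp (v d))
      (M.Adj (v 0) (v 1) ↔ ¬g 0 ∧ ¬g 1) ∧ (M.Adj (v 1) (v 2) ↔ ¬g 1 ∧ ¬g 2) ∧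
        (M.Adj (v 2) (v 0) ↔ ¬g 2 ∧ ¬g 0) ∧
        (g 0 ∧ g 1 ∧ g 2 ∨ ExactlyOne (g 0) (g 1) (g 2)) := by
  rw [isPerfectMatching_iff_exactlyOne]
  dsimp only
  simp only [← exactlyOne_triangle_iff]
  constructor
  -- The sides are oriented cyclically as 01, 12, 20, so at each corner the side to `d + 2` has to
  -- be reversed.
  · refine fun h c s => ⟨?_, ?_, ?_⟩
    · rw [M.adj_comm (c, s, 2)]; exact h (c, s, 0)
    · rw [M.adj_comm (c, s, 0)]; exact h (c, s, 1)
    · rw [M.adj_comm (c, s, 1)]; exact h (c, s, 2)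
  · rintro h ⟨c, s, d⟩
    obtain ⟨h₀, h₁, h₂⟩ := h c s
    rw [M.adj_comm (c, s, 2)] at h₀
    rw [M.adj_comm (c, s, 0)] at h₁
    rw [M.adj_comm (c, s, 1)] at h₂
    fin_cases d
    exacts [h₀, h₁, h₂]

/-! ### Matchings correspond to odd bond sets -/

/-- The subgraph formed by a set of bonds and the sides of triangles that do not meet it. -/
def matchingOf (K : Set (BondIndex n m)) (f : BondIndex n m → ZMod 2) : (lattice K).Subgraph where
  verts := Set.univ
  Adj u v := (lattice K).Adj u v ∧
    (SameTriangle u v ∧ f (bondAt u) = 0 ∧ f (bondAt v) = 0 ∨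
      bondAt u = bondAt v ∧ f (bondAt u) = 1)
  adj_sub h := h.1
  edge_vert _ := trivial
  symm := ⟨by
    rintro u v ⟨h, ⟨h₁, h₂, h₃⟩ | ⟨h₁, h₂⟩⟩
    · exact ⟨h.symm, Or.inl ⟨⟨h₁.1.symm, h₁.2.symm⟩, h₃, h₂⟩⟩
    · exact ⟨h.symm, Or.inr ⟨h₁.symm, h₁ ▸ h₂⟩⟩⟩

section Correspondence

variable {K : Set (BondIndex n m)} {f : BondIndex n m → ZMod 2}

theorem matchingOf_adj_opp (hf : ∀ e, e ∉ K → f e = 0) (v : Vertex n m) :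
    (matchingOf K f).Adj v (opp v) ↔ f (bondAt v) = 1 := by
  constructor
  · rintro ⟨-, h | h⟩
    · exact absurd h.1 (not_sameTriangle_opp v)
    · exact h.2
  · intro h
    have hK : bondAt v ∈ K := by
      by_contra hK
      rw [hf _ hK] at h
      exact absurd h (by decide)
    exact ⟨⟨(opp_ne v).symm, Or.inr ⟨(bondAt_opp v).symm, hK⟩⟩, Or.inr ⟨(bondAt_opp v).symm, h⟩⟩

theorem matchingOf_adj_of_ne (c : Fin (m + 1) × Fin (n + 1)) (s : Bool) {d d' : Fin 3}
    (hd : d ≠ d') : (matchingOf K f).Adj (c, s, d) (c, s, d') ↔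
      f (bondAt (c, s, d)) = 0 ∧ f (bondAt (c, s, d')) = 0 := by
  constructor
  · rintro ⟨-, h | h⟩
    · exact h.2
    · exact absurd (congrArg Prod.snd h.1) hd
  · intro h
    exact ⟨⟨fun h' => hd (congrArg (fun x : Vertex n m => x.2.2) h'), Or.inl ⟨rfl, rfl⟩⟩,
      Or.inl ⟨⟨rfl, rfl⟩, h⟩⟩

theorem matchingOf_isPerfectMatching (hf : f ∈ OddBondSets K) :
    (matchingOf K f).IsPerfectMatching := by
  rw [isPerfectMatching_iff_triangle]
  intro c s
  dsimp only
  rw [matchingOf_adj_of_ne c s (by decide), matchingOf_adj_of_ne c s (by decide),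
    matchingOf_adj_of_ne c s (by decide)]
  simp only [matchingOf_adj_opp hf.1, zmod_two_ne_one_iff, true_and]
  exact (zmod_two_add_eq_one_iff _ _ _).1 (hf.2 c s)

theorem matchingOf_injOn : Set.InjOn (matchingOf K) (OddBondSets K) := by
  intro f hf f' hf' h
  funext e
  have key : ∀ x y : ZMod 2, (x = 1 ↔ y = 1) → x = y := by decide
  apply key
  rw [← bondAt_src e, ← matchingOf_adj_opp hf.1, ← matchingOf_adj_opp hf'.1, h]

-- The witness is the indicator of the bonds used by `M`; the triangle criterion gives its parity
-- and forces the sides.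
open Classical in
theorem exists_matchingOf_eq {M : (lattice K).Subgraph} (hM : M.IsPerfectMatching) :
    ∃ f ∈ OddBondSets K, matchingOf K f = M := by
  let f : BondIndex n m → ZMod 2 := fun e => if M.Adj (src e) (opp (src e)) then 1 else 0
  have hfv : ∀ v, f (bondAt v) = 1 ↔ M.Adj v (opp v) := by
    intro v
    have h₁ : f (bondAt v) = 1 ↔ M.Adj (src (bondAt v)) (opp (src (bondAt v))) := by
      simp [f]
    rw [h₁]
    obtain h | h := eq_or_eq_opp_of_bondAt_eq (bondAt_src (bondAt v)).symm
    · rw [h]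
    · rw [h, opp_opp, M.adj_comm]
  have hfv' : ∀ v, f (bondAt v) = 0 ↔ ¬ M.Adj v (opp v) := fun v => by
    rw [← hfv, zmod_two_ne_one_iff]
  have hf₀ : ∀ e, e ∉ K → f e = 0 := by
    intro e he
    rw [← bondAt_src e, hfv']
    intro h
    obtain ⟨-, h | h⟩ := M.adj_sub h
    · exact not_sameTriangle_opp _ h
    · exact he (by simpa using h.2)
  have hspan := hM.2
  rw [isPerfectMatching_iff_triangle] at hM
  refine ⟨f, ⟨hf₀, fun c s => ?_⟩, ?_⟩
  · rw [zmod_two_add_eq_one_iff]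
    simpa only [hfv] using (hM c s).2.2.2
  · have hne : ∀ c s d d', d ≠ d' →
        ((matchingOf K f).Adj (c, s, d) (c, s, d') ↔ M.Adj (c, s, d) (c, s, d')) := by
      intro c s d d' hd
      rw [matchingOf_adj_of_ne c s hd, hfv', hfv']
      obtain ⟨h₁, h₂, h₃, -⟩ := hM c s
      fin_cases d <;> fin_cases d' <;> first | exact absurd rfl hd | skip
      · exact h₁.symm
      · rw [M.adj_comm (c, s, _) (c, s, _), and_comm]; exact h₃.symm
      · rw [M.adj_comm (c, s, _) (c, s, _), and_comm]; exact h₁.symm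
      · exact h₂.symm
      · exact h₃.symm
      · rw [M.adj_comm (c, s, _) (c, s, _), and_comm]; exact h₂.symm
    have hadj : ∀ u v, (lattice K).Adj u v → ((matchingOf K f).Adj u v ↔ M.Adj u v) := by
      rintro ⟨c, s, d⟩ v h
      have key : ∀ d : Fin 3, d ≠ d + 1 ∧ d ≠ d + 2 := by decide
      obtain rfl | rfl | rfl := eq_or_eq_of_lattice_adj h
      · exact hne c s _ _ (key d).1
      · exact hne c s _ _ (key d).2
      · rw [matchingOf_adj_opp hf₀, hfv]
    refine SimpleGraph.Subgraph.ext ?_ ?_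
    · exact (SimpleGraph.Subgraph.isSpanning_iff.1 hspan).symm
    · funext u v
      exact propext ⟨fun h => (hadj u v h.1).1 h, fun h => (hadj u v (M.adj_sub h)).2 h⟩

theorem numPerfectMatchings_lattice (K : Set (BondIndex n m)) :
    numPerfectMatchings (lattice K) = (OddBondSets K).ncard := by
  have h : {M : (lattice K).Subgraph | M.IsPerfectMatching} = matchingOf K '' OddBondSets K := by
    ext M
    constructor
    · intro hM
      exact exists_matchingOf_eq hM
    · rintro ⟨f, hf, rfl⟩
      exact matchingOf_isPerfectMatching hf
  rw [numPerfectMatchings, h, matchingOf_injOn.ncard_image]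

end Correspondence

/-! ### Counts and entropy -/

theorem numPerfectMatchings_RT :
    numPerfectMatchings (RT n m) = 2 ^ (m * n + m + n + 2) := by
  rw [RT_eq_lattice, numPerfectMatchings_lattice, ncard_oddBondSets_univ]

theorem numPerfectMatchings_RC :
    numPerfectMatchings (RC n m) = 2 ^ (m * n + m + 1) := by
  rw [RC_eq_lattice, numPerfectMatchings_lattice, ncard_oddBondSets_cylinder]

theorem numPerfectMatchings_RF :
    numPerfectMatchings (RF n m) = 2 ^ (m * n) := by
  rw [RF_eq_lattice, numPerfectMatchings_lattice, ncard_oddBondSets_free]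

/-- The entropy is determined by the leading term of the exponent. -/
theorem hasEntropy_of_pow (G : ∀ n m, SimpleGraph (Vertex n m)) (A B C : ℕ)
    (h : ∀ n m, numPerfectMatchings (G n m) = 2 ^ (m * n + A * m + B * n + C)) :
    HasEntropy G (1 / 3 * Real.log 2) := by
  have hu : Tendsto (fun p : ℕ × ℕ => 1 / ((p.1 : ℝ) + 1)) (atTop ×ˢ atTop) (𝓝 0) :=
    tendsto_one_div_add_atTop_nhds_zero_nat.comp tendsto_fst
  have hv : Tendsto (fun p : ℕ × ℕ => 1 / ((p.2 : ℝ) + 1)) (atTop ×ˢ atTop) (𝓝 0) :=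
    tendsto_one_div_add_atTop_nhds_zero_nat.comp tendsto_snd
  -- This is the entropy quotient rewritten with `m / (m + 1) = 1 - 1 / (m + 1)`, and likewise for
  -- `n`; the terms in `A`, `B`, `C` each keep a factor tending to zero.
  have hlim : Tendsto (fun p : ℕ × ℕ => 1 / 3 * Real.log 2 *
      ((1 - 1 / ((p.2 : ℝ) + 1)) * (1 - 1 / ((p.1 : ℝ) + 1))
        + A * (1 - 1 / ((p.2 : ℝ) + 1)) * (1 / ((p.1 : ℝ) + 1))
        + B * (1 - 1 / ((p.1 : ℝ) + 1)) * (1 / ((p.2 : ℝ) + 1))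
        + C * (1 / ((p.1 : ℝ) + 1)) * (1 / ((p.2 : ℝ) + 1)))) (atTop ×ˢ atTop)
      (𝓝 (1 / 3 * Real.log 2 * ((1 - 0) * (1 - 0) + A * (1 - 0) * 0 + B * (1 - 0) * 0
        + C * 0 * 0))) := by
    have h1u := hu.const_sub 1
    have h1v := hv.const_sub 1
    exact ((((h1v.mul h1u).add ((h1v.const_mul (A : ℝ)).mul hu)).add
      ((h1u.const_mul (B : ℝ)).mul hv)).add ((hu.const_mul (C : ℝ)).mul hv)).const_mul _
  have hval : 1 / 3 * Real.log 2 * ((1 - 0) * (1 - 0) + (A : ℝ) * (1 - 0) * 0 + B * (1 - 0) * 0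
      + C * 0 * 0) = 1 / 3 * Real.log 2 := by ring
  rw [hval] at hlim
  refine hlim.congr fun p => ?_
  have h₁ : (p.1 : ℝ) + 1 ≠ 0 := by positivity
  have h₂ : (p.2 : ℝ) + 1 ≠ 0 := by positivity
  have hcard : (Nat.card (Vertex p.1 p.2) : ℝ) = 6 * (p.2 + 1) * (p.1 + 1) := by
    simp only [Nat.card_eq_fintype_card, Fintype.card_prod, Fintype.card_fin, Fintype.card_bool]
    push_cast
    ring
  rw [h, hcard]
  push_cast
  rw [Real.log_pow]
  push_cast
  field_simp
  ring

end TwelveTwelve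

theorem theorem3p2 :
    (∀ n m : ℕ,
      numPerfectMatchings (TwelveTwelve.RT n m) = 2 ^ (m * n + m + n + 2) ∧
      numPerfectMatchings (TwelveTwelve.RC n m) = 2 ^ (m * n + m + 1) ∧
      numPerfectMatchings (TwelveTwelve.RF n m) = 2 ^ (m * n)) ∧
    HasEntropy TwelveTwelve.RT (1 / 3 * Real.log 2) ∧
    HasEntropy TwelveTwelve.RC (1 / 3 * Real.log 2) ∧
    HasEntropy TwelveTwelve.RF (1 / 3 * Real.log 2) := by
  open TwelveTwelve in
  exact ⟨fun n m => ⟨numPerfectMatchings_RT, numPerfectMatchings_RC, numPerfectMatchings_RF⟩,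
    hasEntropy_of_pow _ 1 1 2 fun n m => by rw [numPerfectMatchings_RT]; congr 1; ring,
    hasEntropy_of_pow _ 1 0 1 fun n m => by rw [numPerfectMatchings_RC]; congr 1; ring,
    hasEntropy_of_pow _ 0 0 0 fun n m => by rw [numPerfectMatchings_RF]; congr 1; ring⟩
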